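/- Let $B$ be a unital $C^*$-algebra, let $A\subseteq B$ be a norm-closed subalgebra containing $1_B$ (a unital operator algebra), and let $D\subseteq A$ be a $C^*$-subalgebra of $B$ with $1_B\in D$. A \emph{$D$-character} of $A$ is a contractive (complex-linear) homomorphism $\Phi:A\to D$ which restricts to the identity map on $D$. For elements $x,y$ of $B$ of norm $<1$ let $$\rho(x,y)=\tanh^{-1}\bigl\|(1-xx^*)^{-1/2}(x-y)(1-x^*y)^{-1}(1-x^*x)^{1/2}\bigr\| .$$ Then for all $D$-characters $\Phi,\Psi$ of $A$ the following are equivalent: \begin{enumerate} \item[(1)] $\|\Phi-\Psi\|<2$; \item[(2)] $\|\Phi|_{\operatorname{Ker}\Psi}\|<1$; \item[(3)] there is a constant $M>0$ with $\rho(\Phi(a),\Psi(a))\le M$ for all $a\in A$ with $\|a\|<1$; \item[(4)] for every sequence $(a_n)$ in $A$ with $\|a_n\|\le 1$ for all $n$, if $\|\Phi(a_n)\|\to 1$ then $\|\Psi(a_n)\|\to 1$. \end{enumerate} Moreover, the relation on the set of $D$-characters of $A$ defined by any one of these conditions (\emph{Gleason equivalence}) is an equivalence relation; in particular its classes, called \emph{Gleason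 parts}, partition the set of $D$-characters of $A$. -/

import Mathlib

open Filter Topology

noncomputable section

/-- The hyperbolic distance
`ρ(x, y) = artanh ‖(1 - x x*)^(-1/2) (x - y) (1 - x* y)⁻¹ (1 - x* x)^(1/2)‖`
between strict contractions `x, y` of a unital C⋆-algebra; the powers are taken in the continuous
functional calculus. (For `‖x‖ < 1`, `‖y‖ < 1` the element `1 - x* y` is invertible, and the
spectra of `1 - x x*` and `1 - x* x` lie in `(0, 1]`.) -/
def hyperbolicDist {B : Type*} [CStarAlgebra B] (x y : B) : ℝ :=
  Real.artanh ‖cfc (fun t : ℝ => (Real.sqrt t)⁻¹) (1 - x * star x) * (x - y) *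
    Ring.inverse (1 - star x * y) * cfc (fun t : ℝ => Real.sqrt t) (1 - star x * x)‖

/-- A `D`-character of `A`, where `D ⊆ A ⊆ B` with common unit: a contractive homomorphism
`A → D` which restricts to the identity map on `D`. -/
structure DCharacter {B : Type*} [CStarAlgebra B] (A : Subalgebra ℂ B) (D : StarSubalgebra ℂ B)
    (hDA : D.toSubalgebra ≤ A) where
  toAlgHom : A →ₐ[ℂ] D
  contractive : ∀ a : A, ‖toAlgHom a‖ ≤ ‖a‖
  map_of_mem : ∀ d : D, toAlgHom ⟨(d : B), hDA d.2⟩ = d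

namespace DCharacter

variable {B : Type*} [CStarAlgebra B] {A : Subalgebra ℂ B} {D : StarSubalgebra ℂ B}
  {hDA : D.toSubalgebra ≤ A}

/-- A `D`-character is a `D`-bimodule map. -/
theorem map_bimodule (Φ : DCharacter A D hDA) (d₁ d₂ : D) (a : A) :
    Φ.toAlgHom (⟨(d₁ : B), hDA d₁.2⟩ * a * ⟨(d₂ : B), hDA d₂.2⟩) = d₁ * Φ.toAlgHom a * d₂ := by
  rw [map_mul, map_mul, Φ.map_of_mem, Φ.map_of_mem]

/-- A `D`-character as a bounded linear map. -/
def toCLM (Φ : DCharacter A D hDA) : A →L[ℂ] D :=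
  Φ.toAlgHom.toLinearMap.mkContinuous 1 (fun a => by simpa using Φ.contractive a)

/-- The Gleason relation `‖Φ - Ψ‖ < 2`. -/
def GleasonEquiv (Φ Ψ : DCharacter A D hDA) : Prop :=
  ‖Φ.toCLM - Ψ.toCLM‖ < 2

/-- The restriction of `Φ` to the kernel of `Ψ` has norm `< 1`. -/
def KerNormLtOne (Φ Ψ : DCharacter A D hDA) : Prop :=
  ‖Φ.toCLM.comp (LinearMap.ker Ψ.toCLM.toLinearMap).subtypeL‖ < 1

/-- The hyperbolic distance of `Φ a` and `Ψ a` is bounded on the open unit ball of `A`. -/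
def BoundedHyperbolicDist (Φ Ψ : DCharacter A D hDA) : Prop :=
  ∃ M : ℝ, 0 < M ∧ ∀ a : A, ‖a‖ < 1 →
    hyperbolicDist (Φ.toAlgHom a : B) (Ψ.toAlgHom a : B) ≤ M

/-- If `‖Φ (aₙ)‖ → 1` for a sequence in the closed unit ball of `A`, then `‖Ψ (aₙ)‖ → 1`. -/
def NormingSeq (Φ Ψ : DCharacter A D hDA) : Prop :=
  ∀ a : ℕ → A, (∀ n, ‖a n‖ ≤ 1) →
    Tendsto (fun n => ‖Φ.toAlgHom (a n)‖) atTop (𝓝 1) →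
    Tendsto (fun n => ‖Ψ.toAlgHom (a n)‖) atTop (𝓝 1)

/-- The Gleason part of `Φ`. -/
def gleasonPart (Φ : DCharacter A D hDA) : Set (DCharacter A D hDA) :=
  {Ψ | GleasonEquiv Φ Ψ}

end DCharacter

end

/-! The hub is (2). If `r` is the norm of `Φ` on `Ker Ψ`, then `a - Ψ a ∈ Ker Ψ` has norm at most
`2‖a‖` and `Φ` sends it to `Φ a - Ψ a`, so `‖Φ - Ψ‖ ≤ 2r`. Conversely, for `a ∈ Ker Ψ` the element
`b = (Φ a)* a` satisfies `Ψ b = 0` and `Φ b ≥ 0`; a scalar Möbius map sends `b` to a contraction on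
which `Φ` and `Ψ` nearly differ by `1 + s` when `‖Φ a‖` is near `1`. Taking `s < 1` with `1 + s > ‖Φ
- Ψ‖` bounds `‖Φ a‖` away from `1`. High powers of the same `b` give (4), and kernel elements refute
(4) when (2) fails. For (3), the Möbius map based at `Φ a` moves `a` into `Ker Φ` and commutes with
`Ψ`; this yields (2) with the roles exchanged, which the symmetry of (1) repairs. Symmetry is
evident in (1), transitivity in (4). -/

noncomputable section

/-! ### Möbius maps on the unit ball of a C⋆-algebra -/

section CStarAlgebra

variable {B : Type*} [CStarAlgebra B]

/-- If `u* u ≤ w* w` then `u w⁻¹` is a contraction. -/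
theorem norm_mul_le_one_of_star_mul_le [PartialOrder B] [StarOrderedRing B] {u v w : B}
    (hwv : w * v = 1) (h : star u * u ≤ star w * w) : ‖u * v‖ ≤ 1 := by
  have h1 : star (u * v) * (u * v) ≤ 1 := by
    calc star (u * v) * (u * v) = star v * (star u * u) * v := by simp only [star_mul, mul_assoc]
      _ ≤ star v * (star w * w) * v := star_left_conjugate_le_conjugate h v
      _ = star (w * v) * (w * v) := by simp only [star_mul, mul_assoc]
      _ = 1 := by simp [hwv]
  have h2 := (CStarAlgebra.norm_le_one_iff_of_nonneg _ (star_mul_self_nonneg (u * v))).2 h1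
  rw [CStarRing.norm_star_mul_self] at h2
  nlinarith [norm_nonneg (u * v)]

theorem one_sub_star_mul_self_nonneg [PartialOrder B] [StarOrderedRing B] {y : B} (hy : ‖y‖ ≤ 1) :
    0 ≤ 1 - star y * y := by
  rw [sub_nonneg, ← CStarAlgebra.norm_le_one_iff_of_nonneg _ (star_mul_self_nonneg y),
    CStarRing.norm_star_mul_self]
  nlinarith [norm_nonneg y]

theorem spectrum_one_sub_star_mul_self_pos {x : B} (hx : ‖x‖ < 1) {t : ℝ}
    (ht : t ∈ spectrum ℝ (1 - star x * x)) : 0 < t := by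
  rcases subsingleton_or_nontrivial B
  · simp [spectrum.of_subsingleton] at ht
  rw [← map_one (algebraMap ℝ B), ← spectrum.singleton_sub_eq] at ht
  obtain ⟨_, rfl, s, hs, rfl⟩ := ht
  have h1 := (Real.le_norm_self s).trans (spectrum.norm_le_norm_of_mem hs)
  rw [CStarRing.norm_star_mul_self] at h1
  have h2 : ‖x‖ * ‖x‖ < 1 := by nlinarith [norm_nonneg x]
  simp only
  linarith

theorem norm_mul_lt_one_of_lt_of_le {x y : B} (hx : ‖x‖ < 1) (hy : ‖y‖ ≤ 1) : ‖x * y‖ < 1 :=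
  (norm_mul_le x y).trans_lt (by nlinarith [norm_nonneg x, norm_nonneg y])

theorem cfc_sqrt_mul_inv_sqrt {p : B} (hp : IsSelfAdjoint p) (h : ∀ t ∈ spectrum ℝ p, 0 < t) :
    cfc (fun t : ℝ => (√t)⁻¹) p * cfc (fun t : ℝ => √t) p = 1 := by
  have hc : ContinuousOn (fun t : ℝ => (√t)⁻¹) (spectrum ℝ p) :=
    Real.continuous_sqrt.continuousOn.inv₀ fun t ht => (Real.sqrt_pos.2 (h t ht)).ne'
  rw [← cfc_mul _ _ p hc Real.continuous_sqrt.continuousOn, ← cfc_one ℝ p]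
  exact cfc_congr fun t ht => inv_mul_cancel₀ (Real.sqrt_pos.2 (h t ht)).ne'

theorem cfc_sqrt_mul_self {p : B} (hp : IsSelfAdjoint p) (h : ∀ t ∈ spectrum ℝ p, 0 < t) :
    cfc (fun t : ℝ => √t) p * cfc (fun t : ℝ => √t) p = p := by
  rw [← cfc_mul _ _ p Real.continuous_sqrt.continuousOn Real.continuous_sqrt.continuousOn]
  conv_rhs => rw [← cfc_id ℝ p]
  exact cfc_congr fun t ht => Real.mul_self_sqrt (h t ht).le

/-- The Möbius transformation of the unit ball occurring in `hyperbolicDist`. -/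
def mobius (x y : B) : B :=
  cfc (fun t : ℝ => (Real.sqrt t)⁻¹) (1 - x * star x) * (x - y) *
    Ring.inverse (1 - star x * y) * cfc (fun t : ℝ => Real.sqrt t) (1 - star x * x)

theorem hyperbolicDist_eq_artanh_norm_mobius (x y : B) :
    hyperbolicDist x y = Real.artanh ‖mobius x y‖ := rfl

@[simp]
theorem mobius_self (x : B) : mobius x x = 0 := by simp [mobius]

@[simp]
theorem mobius_zero_left (y : B) : mobius 0 y = -y := by
  have h (f : ℝ → ℝ) (hf : f 1 = 1) : cfc f (1 : B) = 1 := by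
    rw [← map_one (algebraMap ℝ B), cfc_algebraMap, hf]
  simp [mobius, h]

/-- With `r = (1 - x* x)⁻¹` and `s = (1 - x x*)⁻¹`, this is `w* w - u* u = 1 - y* y`, where `mobius
x y` is `u w⁻¹`; positivity of the right side makes the Möbius map contractive. -/
theorem gram_identity {x y r s : B} (hr : r * (1 - star x * x) = 1)
    (hs : s * (1 - x * star x) = 1) (hxr : x * r = s * x) (hrx : r * star x = star x * s) :
    (1 - star y * x) * r * (1 - star x * y) - (star x - star y) * s * (x - y) =
      1 - star y * y := by
  have h1 : r * star x * x = r - 1 := by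
    rw [mul_sub, mul_one, sub_eq_iff_eq_add] at hr
    rw [mul_assoc]; nth_rw 2 [hr]; abel
  have h2 : s * x * star x = s - 1 := by
    rw [mul_sub, mul_one, sub_eq_iff_eq_add] at hs
    rw [mul_assoc]; nth_rw 2 [hs]; abel
  calc _ = r - r * star x * y - star y * (x * r) + star y * (x * r) * star x * y
        - star x * s * x + star x * s * y + star y * (s * x) - star y * s * y := by noncomm_ring
    _ = r - r * star x * x + star y * (s * x * star x - s) * y := by
      rw [hxr, ← hrx]; noncomm_ring
    _ = 1 - star y * y := by rw [h1, h2]; noncomm_ring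

theorem norm_mobius_le_one {x y : B} (hx : ‖x‖ < 1) (hy : ‖y‖ ≤ 1) : ‖mobius x y‖ ≤ 1 := by
  let _ : PartialOrder B := CStarAlgebra.spectralOrder B
  have : StarOrderedRing B := CStarAlgebra.spectralOrderedRing B
  have hx' : ‖star x‖ < 1 := by rwa [norm_star]
  have hP : IsSelfAdjoint (1 - star x * x) := .sub (.one B) (.star_mul_self x)
  have hQ : IsSelfAdjoint (1 - x * star x) := .sub (.one B) (.mul_star_self x)
  have hPs := fun t => spectrum_one_sub_star_mul_self_pos (t := t) hx
  have hQs := fun t => spectrum_one_sub_star_mul_self_pos (t := t) hx'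
  rw [star_star] at hQs
  have hP1 := cfc_sqrt_mul_inv_sqrt hP hPs
  have hP2 := cfc_sqrt_mul_self hP hPs
  have hQ1 := cfc_sqrt_mul_inv_sqrt hQ hQs
  have hQ2 := cfc_sqrt_mul_self hQ hQs
  have hpp := (cfc_commute_cfc (fun t : ℝ => (√t)⁻¹) (fun t => √t) (1 - star x * x)).eq
  have hqq := (cfc_commute_cfc (fun t : ℝ => (√t)⁻¹) (fun t => √t) (1 - x * star x)).eq
  have hp'sa : star (cfc (fun t : ℝ => (√t)⁻¹) (1 - star x * x)) = _ :=
    (cfc_predicate (fun t : ℝ => (√t)⁻¹) (1 - star x * x)).star_eq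
  have hq'sa : star (cfc (fun t : ℝ => (√t)⁻¹) (1 - x * star x)) = _ :=
    (cfc_predicate (fun t : ℝ => (√t)⁻¹) (1 - x * star x)).star_eq
  unfold mobius
  set p := cfc (fun t : ℝ => √t) (1 - star x * x)
  set p' := cfc (fun t : ℝ => (√t)⁻¹) (1 - star x * x)
  set q := cfc (fun t : ℝ => √t) (1 - x * star x)
  set q' := cfc (fun t : ℝ => (√t)⁻¹) (1 - x * star x)
  have hr : p' * p' * (1 - star x * x) = 1 := by
    rw [← hP2, mul_assoc, ← mul_assoc p' p p, hP1, one_mul, hP1]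
  have hr' : (1 - star x * x) * (p' * p') = 1 := by
    rw [← hP2, mul_assoc, ← mul_assoc p p' p', ← hpp, hP1, one_mul, ← hpp, hP1]
  have hs : q' * q' * (1 - x * star x) = 1 := by
    rw [← hQ2, mul_assoc, ← mul_assoc q' q q, hQ1, one_mul, hQ1]
  have hs' : (1 - x * star x) * (q' * q') = 1 := by
    rw [← hQ2, mul_assoc, ← mul_assoc q q' q', ← hqq, hQ1, one_mul, ← hqq, hQ1]
  have hxr : x * (p' * p') = q' * q' * x := by
    calc x * (p' * p') = q' * q' * ((1 - x * star x) * x) * (p' * p') := by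
          rw [← mul_assoc (q' * q'), hs, one_mul]
      _ = q' * q' * x * ((1 - star x * x) * (p' * p')) := by noncomm_ring
      _ = q' * q' * x := by rw [hr', mul_one]
  have hrx : p' * p' * star x = star x * (q' * q') := by
    simpa [hp'sa, hq'sa] using congr_arg star hxr
  have hu : IsUnit (1 - star x * y) :=
    isUnit_one_sub_of_norm_lt_one (norm_mul_lt_one_of_lt_of_le hx' hy)
  rw [mul_assoc (q' * (x - y))]
  refine norm_mul_le_one_of_star_mul_le (w := p' * (1 - star x * y)) ?_ ?_
  · rw [mul_assoc, ← mul_assoc (1 - star x * y), Ring.mul_inverse_cancel _ hu, one_mul, hP1]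
  · rw [← sub_nonneg]
    refine (one_sub_star_mul_self_nonneg hy).trans_eq ?_
    rw [← gram_identity hr hs hxr hrx]
    simp [hp'sa, hq'sa, mul_assoc]

/-- Scalar Möbius transformations preserve the closed unit ball. -/
theorem norm_sub_smul_one_mul_le_one {b v : B} {s : ℝ} (hs0 : 0 ≤ s) (hs : s < 1) (hb : ‖b‖ ≤ 1)
    (hv : (1 - (s : ℂ) • b) * v = 1) : ‖(b - (s : ℂ) • 1) * v‖ ≤ 1 := by
  let _ : PartialOrder B := CStarAlgebra.spectralOrder B
  have : StarOrderedRing B := CStarAlgebra.spectralOrderedRing B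
  refine norm_mul_le_one_of_star_mul_le hv ?_
  rw [← sub_nonneg]
  have h : (0 : B) ≤ (1 - s ^ 2 : ℝ) • (1 - star b * b) :=
    smul_nonneg (by nlinarith) (one_sub_star_mul_self_nonneg hb)
  refine h.trans_eq ?_
  rw [← Complex.coe_smul]
  simp only [star_sub, star_smul, star_one, Complex.star_def, Complex.conj_ofReal, mul_sub, sub_mul,
    smul_mul_assoc, mul_smul_comm, one_mul, mul_one, Complex.ofReal_sub, Complex.ofReal_pow,
    Complex.ofReal_one]
  module

/-- The spectral mapping `t ↦ (t - s) / (1 - s t) + s` bounds the norm of the Möbius transform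
from below. -/
theorem le_norm_sub_smul_one_mul_add {h v : B} (hh : ‖h‖ ∈ spectrum ℝ h) {s : ℝ}
    (hs0 : 0 ≤ s) (hs : s < 1) (h1 : ‖h‖ ≤ 1) (hv : IsUnit v) (hv1 : (1 - (s : ℂ) • h) * v = 1) :
    (1 - s ^ 2) * ‖h‖ ≤ ‖(h - (s : ℂ) • 1) * v + (s : ℂ) • 1‖ * (1 - s * ‖h‖) := by
  nontriviality B
  set t := ‖h‖
  have ht : 0 < 1 - s * t := by nlinarith [norm_nonneg h]
  -- `c` is the scalar value `(t - s) / (1 - s t) + s`, and `e` equals `(1 - s²) / (1 - s t)`.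
  set c := (1 - s ^ 2) * t / (1 - s * t)
  have hc : c * (1 - s * t) = (1 - s ^ 2) * t := div_mul_cancel₀ _ ht.ne'
  set e := 1 - s ^ 2 + c * s
  have he : 0 < e := by
    have : 0 ≤ c := div_nonneg (mul_nonneg (by nlinarith) (norm_nonneg h)) ht.le
    have : 0 ≤ c * s := mul_nonneg this hs0
    simp only [e]; nlinarith
  have hce : c = e * t := by simp only [e]; linarith
  have key : algebraMap ℝ B c - ((h - (s : ℂ) • 1) * v + (s : ℂ) • 1) =
      e • ((algebraMap ℝ B t - h) * v) := by
    have : algebraMap ℝ B c - ((h - (s : ℂ) • 1) * v + (s : ℂ) • 1) =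
        (((c : ℂ) - s) • (1 - (s : ℂ) • h) - (h - (s : ℂ) • 1)) * v := by
      rw [sub_mul (((c : ℂ) - s) • (1 - (s : ℂ) • h)), smul_mul_assoc, hv1, Algebra.algebraMap_eq_smul_one, ← Complex.coe_smul]
      module
    rw [this, ← smul_mul_assoc, Algebra.algebraMap_eq_smul_one, ← Complex.coe_smul,
      ← Complex.coe_smul]
    congr 1
    have hc' : (c : ℂ) = e * t := by exact_mod_cast hce
    have he' : (e : ℂ) = 1 - s ^ 2 + c * s := by simp [e]
    rw [smul_sub (e : ℂ), smul_smul (e : ℂ), ← hc', he']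
    module
  -- By `key`, invertibility here would make `t - h` invertible, as `e ≠ 0` and `v` is a unit.
  have hmem : c ∈ spectrum ℝ ((h - (s : ℂ) • 1) * v + (s : ℂ) • 1) := by
    rw [spectrum.mem_iff, key]
    intro hu
    refine spectrum.mem_iff.1 hh ?_
    have h2 := hu.smul (Units.mk0 e he.ne')⁻¹
    rw [Units.smul_def, smul_smul] at h2
    simp only [Units.val_inv_eq_inv_val, Units.val_mk0, inv_mul_cancel₀ he.ne', one_smul] at h2
    have h3 := h2.mul hv.unit⁻¹.isUnit
    rwa [mul_assoc, IsUnit.mul_val_inv, mul_one] at h3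
  have h4 := (Real.le_norm_self c).trans (spectrum.norm_le_norm_of_mem hmem)
  rw [← hc]
  exact mul_le_mul_of_nonneg_right h4 ht.le

theorem map_ringInverse_of_isUnit {R S : Type*} [MonoidWithZero R] [MonoidWithZero S] {F : Type*}
    [FunLike F R S] [MonoidHomClass F R S] (f : F) {a : R} (ha : IsUnit a) :
    f (Ring.inverse a) = Ring.inverse (f a) := by
  obtain ⟨u, rfl⟩ := ha
  rw [Ring.inverse_unit, show f u = (Units.map (f : R →* S) u : S) from rfl, Ring.inverse_unit]
  rfl

end CStarAlgebra

/-! ### Norm gap, kernels and norming sequences of `D`-characters -/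

namespace DCharacter

variable {B : Type*} [CStarAlgebra B] {A : Subalgebra ℂ B} {D : StarSubalgebra ℂ B}
  {hDA : D.toSubalgebra ≤ A}

@[simp]
theorem toCLM_apply (Φ : DCharacter A D hDA) (a : A) : Φ.toCLM a = Φ.toAlgHom a := rfl

theorem norm_le_one (Φ : DCharacter A D hDA) {a : A} (ha : ‖a‖ ≤ 1) : ‖Φ.toAlgHom a‖ ≤ 1 :=
  (Φ.contractive a).trans ha

theorem gleasonEquiv_comm {Φ Ψ : DCharacter A D hDA} : Φ.GleasonEquiv Ψ ↔ Ψ.GleasonEquiv Φ := by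
  rw [GleasonEquiv, GleasonEquiv, ← neg_sub, ContinuousLinearMap.opNorm_neg]

theorem norm_le_of_mem_ker (Φ Ψ : DCharacter A D hDA) {a : A} (ha : Ψ.toAlgHom a = 0) :
    ‖Φ.toAlgHom a‖ ≤
      ‖Φ.toCLM.comp (LinearMap.ker Ψ.toCLM.toLinearMap).subtypeL‖ * ‖a‖ :=
  (Φ.toCLM.comp (LinearMap.ker Ψ.toCLM.toLinearMap).subtypeL).le_opNorm ⟨a, ha⟩

theorem exists_mem_ker_lt (Φ Ψ : DCharacter A D hDA) {r : ℝ}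
    (hr : r < ‖Φ.toCLM.comp (LinearMap.ker Ψ.toCLM.toLinearMap).subtypeL‖) :
    ∃ a : A, Ψ.toAlgHom a = 0 ∧ ‖a‖ < 1 ∧ r < ‖Φ.toAlgHom a‖ := by
  obtain ⟨⟨a, ha⟩, h1, h2⟩ := ContinuousLinearMap.exists_lt_apply_of_lt_opNorm _ hr
  exact ⟨a, ha, h1, h2⟩

theorem KerNormLtOne.gleasonEquiv {Φ Ψ : DCharacter A D hDA} (h : Φ.KerNormLtOne Ψ) :
    Φ.GleasonEquiv Ψ := by
  set r := ‖Φ.toCLM.comp (LinearMap.ker Ψ.toCLM.toLinearMap).subtypeL‖ with hr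
  have h' : r < 1 := h
  refine lt_of_le_of_lt (ContinuousLinearMap.opNorm_le_bound _
    (mul_nonneg zero_le_two (ContinuousLinearMap.opNorm_nonneg _ : 0 ≤ r)) fun a => ?_)
    (by linarith : 2 * r < 2)
  set d : A := ⟨(Ψ.toAlgHom a : B), hDA (Ψ.toAlgHom a).2⟩
  have h1 := Φ.norm_le_of_mem_ker Ψ (a := a - d) (by rw [map_sub, Ψ.map_of_mem, sub_self])
  rw [map_sub, Φ.map_of_mem, ← hr] at h1
  have h2 : ‖a - d‖ ≤ ‖a‖ + ‖a‖ := (norm_sub_le a d).trans (by gcongr; exact Ψ.contractive a)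
  calc ‖Φ.toAlgHom a - Ψ.toAlgHom a‖ ≤ r * ‖a - d‖ := h1
    _ ≤ r * (‖a‖ + ‖a‖) := by gcongr
    _ = 2 * r * ‖a‖ := by ring

/-- `(Φ a)* a` as an element of `A`. -/
def starMul (Φ : DCharacter A D hDA) (a : A) : A :=
  ⟨((star (Φ.toAlgHom a) : D) : B), hDA (star (Φ.toAlgHom a)).2⟩ * a

theorem map_starMul (Φ Ψ : DCharacter A D hDA) (a : A) :
    Ψ.toAlgHom (Φ.starMul a) = star (Φ.toAlgHom a) * Ψ.toAlgHom a := by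
  rw [starMul, map_mul, Ψ.map_of_mem]

theorem norm_starMul_le_one (Φ : DCharacter A D hDA) {a : A} (ha : ‖a‖ ≤ 1) :
    ‖Φ.starMul a‖ ≤ 1 := by
  refine (norm_mul_le _ _).trans (mul_le_one₀ ?_ (norm_nonneg a) ha)
  exact (norm_star ((Φ.toAlgHom a : D) : B)).trans_le (Φ.norm_le_one ha)

theorem GleasonEquiv.kerNormLtOne (hA : IsClosed (A : Set B)) {Φ Ψ : DCharacter A D hDA}
    (h : Φ.GleasonEquiv Ψ) : Φ.KerNormLtOne Ψ := by
  have : CompleteSpace A := hA.completeSpace_coe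
  rcases subsingleton_or_nontrivial B with hB | hB
  · refine lt_of_le_of_lt (ContinuousLinearMap.opNorm_le_bound _ le_rfl fun a => ?_) zero_lt_one
    rw [Subsingleton.elim a 0, map_zero, norm_zero, zero_mul]
  set N := ‖Φ.toCLM - Ψ.toCLM‖
  have hN0 : 0 ≤ N := ContinuousLinearMap.opNorm_nonneg _
  have hN : N < 2 := h
  set s := N / 2
  have hs0 : 0 ≤ s := by positivity
  have hs : s < 1 := by simp only [s]; linarith
  -- `K` solves `(1 - s²) K = N (1 - s K)`; it is below `1` because `(1 - s)(1 + s - N) = (1 - N/2)²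
  -- > 0`.
  set K := N / (1 - s ^ 2 + N * s)
  have hden : 0 < 1 - s ^ 2 + N * s := by
    have := mul_nonneg hN0 hs0
    nlinarith
  have hK : K < 1 := by
    rw [div_lt_one hden]
    simp only [s]
    nlinarith
  by_contra hcon
  obtain ⟨a, ha0, ha1, ha⟩ := Φ.exists_mem_ker_lt Ψ (r := √K)
    (lt_of_lt_of_le ((Real.sqrt_lt' one_pos).2 (by simpa using hK)) (not_lt.1 hcon))
  set b := Φ.starMul a
  have hb1 : ‖b‖ ≤ 1 := Φ.norm_starMul_le_one ha1.le
  have hΨb : Ψ.toAlgHom b = 0 := by rw [map_starMul, ha0, mul_zero]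
  have hu : IsUnit (1 - (s : ℂ) • b) := isUnit_one_sub_of_norm_lt_one <| by
    rw [norm_smul, Complex.norm_real, Real.norm_of_nonneg hs0]
    nlinarith [norm_nonneg b]
  obtain ⟨v, hv⟩ : ∃ v : Aˣ, (1 - (s : ℂ) • b) * (v : A) = 1 := ⟨hu.unit⁻¹, hu.mul_val_inv⟩
  set c : A := (b - (s : ℂ) • 1) * v
  have hc : ‖c‖ ≤ 1 :=
    norm_sub_smul_one_mul_le_one (b := (b : B)) (v := (v : A)) hs0 hs hb1
      (by simpa using congr_arg Subtype.val hv)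
  set x : B := ((Φ.toAlgHom b : D) : B) with hx
  have hxx : x = star (Φ.toAlgHom a : B) * (Φ.toAlgHom a : B) := by
    rw [hx, map_starMul]; rfl
  have hxn : ‖x‖ = ‖Φ.toAlgHom a‖ * ‖Φ.toAlgHom a‖ := by
    rw [hxx, CStarRing.norm_star_mul_self]; rfl
  have hx1 : ‖x‖ ≤ 1 := Φ.norm_le_one hb1
  have hspec : ‖x‖ ∈ spectrum ℝ x := by
    let _ : PartialOrder B := CStarAlgebra.spectralOrder B
    have : StarOrderedRing B := CStarAlgebra.spectralOrderedRing B
    exact CStarAlgebra.norm_mem_spectrum_of_nonneg (by rw [hxx]; exact star_mul_self_nonneg _)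
  have hΦv := congr_arg (fun z => (Φ.toAlgHom z : B)) hv
  simp only [map_mul, map_sub, map_one, map_smul] at hΦv
  have hΨv : Ψ.toAlgHom (v : A) = 1 := by
    simpa [hΨb, -Complex.coe_smul] using congr_arg Ψ.toAlgHom hv
  have hlow := le_norm_sub_smul_one_mul_add hspec hs0 hs hx1
    (((v.isUnit.map Φ.toAlgHom)).map D.subtype) hΦv
  -- Since `Ψ b = 0`, `Ψ c = -s`.
  have hdiff : ((Φ.toCLM - Ψ.toCLM) c : D) = (Φ.toAlgHom b - (s : ℂ) • 1) * Φ.toAlgHom v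
      + (s : ℂ) • 1 := by
    simp [c, hΨb, hΨv, -Complex.coe_smul]
  have hup := (Φ.toCLM - Ψ.toCLM).le_opNorm_of_le hc
  rw [hdiff, mul_one] at hup
  have hfin : (1 - s ^ 2) * ‖x‖ ≤ N * (1 - s * ‖x‖) :=
    hlow.trans (mul_le_mul_of_nonneg_right hup (by nlinarith [norm_nonneg x]))
  have hxK : ‖x‖ ≤ K := by
    rw [le_div_iff₀ hden]; linarith
  rw [Real.sqrt_lt' ((Real.sqrt_nonneg K).trans_lt ha), sq, ← hxn] at ha
  exact absurd ha (not_lt.2 hxK)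

/-- If `‖Ψ a‖ ≤ c < 1`, powers of `b = (Φ a)* a` are almost killed by `Ψ`. Correcting `b ^ k` by `Ψ
(b ^ k)` gives `‖Φ a‖ ^ (2k) ≤ r (1 + c ^ k) + c ^ k ≤ r + 2 c ^ k`, which is below `1` for large
`k`. -/
theorem KerNormLtOne.normingSeq {Φ Ψ : DCharacter A D hDA} (h : Φ.KerNormLtOne Ψ) :
    Φ.NormingSeq Ψ := by
  intro a ha hlim
  set r := ‖Φ.toCLM.comp (LinearMap.ker Ψ.toCLM.toLinearMap).subtypeL‖ with hrdef
  have hr : r < 1 := h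
  have hr0 : 0 ≤ r := ContinuousLinearMap.opNorm_nonneg _
  refine tendsto_order.2 ⟨fun c hc => ?_, fun c hc =>
    Eventually.of_forall fun n => (Ψ.norm_le_one (ha n)).trans_lt hc⟩
  wlog hc0 : 0 ≤ c generalizing c
  · exact (this 0 zero_lt_one le_rfl).mono fun n hn => (not_le.1 hc0).trans hn
  have hpow : Tendsto (fun m : ℕ => c ^ 2 ^ m) atTop (𝓝 0) :=
    (tendsto_pow_atTop_nhds_zero_of_lt_one hc0 hc).comp
      (tendsto_pow_atTop_atTop_of_one_lt one_lt_two)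
  obtain ⟨m, hm⟩ := (hpow.eventually_lt_const (show 0 < (1 - r) / 2 by linarith)).exists
  have hlim' : Tendsto (fun n => (‖Φ.toAlgHom (a n)‖ * ‖Φ.toAlgHom (a n)‖) ^ 2 ^ m) atTop
      (𝓝 1) := by
    simpa using (hlim.mul hlim).pow (2 ^ m)
  filter_upwards [hlim'.eventually_const_lt (show r + 2 * c ^ 2 ^ m < 1 by linarith)] with n hn
  by_contra! hle
  refine absurd hn (not_lt.2 ?_)
  set X := Φ.toAlgHom (a n)
  set Y := Ψ.toAlgHom (a n)
  set b := Φ.starMul (a n)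
  have hX : ‖X‖ ≤ 1 := Φ.norm_le_one (ha n)
  have hb : ‖b‖ ≤ 1 := Φ.norm_starMul_le_one (ha n)
  have hΨb : ‖Ψ.toAlgHom b‖ ≤ c := by
    rw [map_starMul]
    refine (norm_mul_le _ _).trans ?_
    have : ‖star X‖ ≤ 1 := (norm_star (X : B)).trans_le hX
    exact (mul_le_of_le_one_left (norm_nonneg _) this).trans hle
  have hbk : ‖b ^ 2 ^ m‖ ≤ 1 :=
    (norm_pow_le' b (by positivity)).trans (pow_le_one₀ (norm_nonneg b) hb)
  set w := Ψ.toAlgHom (b ^ 2 ^ m)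
  have hw : ‖w‖ ≤ c ^ 2 ^ m := by
    simp only [w, map_pow]
    exact (norm_pow_le' _ (by positivity)).trans (pow_le_pow_left₀ (norm_nonneg _) hΨb _)
  set d : A := ⟨(w : B), hDA w.2⟩
  have hd : ‖d‖ ≤ c ^ 2 ^ m := hw
  have h1 := Φ.norm_le_of_mem_ker Ψ (a := b ^ 2 ^ m - d)
    (by rw [map_sub, Ψ.map_of_mem, sub_self])
  rw [map_sub, Φ.map_of_mem, ← hrdef] at h1
  have h2 : ‖b ^ 2 ^ m - d‖ ≤ 1 + c ^ 2 ^ m := (norm_sub_le _ _).trans (add_le_add hbk hd)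
  -- `Φ b = X* X` is self-adjoint, so its norm is multiplicative on these powers.
  have h3 : ‖Φ.toAlgHom (b ^ 2 ^ m)‖ = (‖X‖ * ‖X‖) ^ 2 ^ m := by
    rw [map_pow, map_starMul]
    have := (IsSelfAdjoint.star_mul_self (X : B)).norm_pow_two_pow m
    rw [CStarRing.norm_star_mul_self] at this
    exact this
  have h4 := norm_sub_norm_le (Φ.toAlgHom (b ^ 2 ^ m)) w
  have hck : 0 ≤ c ^ 2 ^ m := by positivity
  have h5 : r * ‖b ^ 2 ^ m - d‖ ≤ r * (1 + c ^ 2 ^ m) := by gcongr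
  rw [← h3]
  nlinarith

theorem NormingSeq.kerNormLtOne {Φ Ψ : DCharacter A D hDA} (h : Φ.NormingSeq Ψ) :
    Φ.KerNormLtOne Ψ := by
  by_contra hcon
  have key (n : ℕ) := Φ.exists_mem_ker_lt Ψ (r := 1 - 1 / ((n : ℝ) + 1))
    ((sub_lt_self 1 Nat.one_div_pos_of_nat).trans_le (not_lt.1 hcon))
  choose a ha0 ha1 ha using key
  have h1 : Tendsto (fun n => ‖Φ.toAlgHom (a n)‖) atTop (𝓝 1) := by
    have h2 : Tendsto (fun n : ℕ => 1 - 1 / ((n : ℝ) + 1)) atTop (𝓝 1) := by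
      simpa using tendsto_one_div_add_atTop_nhds_zero_nat.const_sub (1 : ℝ)
    exact tendsto_of_tendsto_of_tendsto_of_le_of_le h2 tendsto_const_nhds
      (fun n => (ha n).le) (fun n => Φ.norm_le_one (ha1 n).le)
  have h3 := h a (fun n => (ha1 n).le) h1
  simp [ha0] at h3

/-! ### Hyperbolic distance -/

/-- The Möbius transform of `a ∈ A` by a strict contraction of `D` lies in `A`, and `D`-characters
commute with it. -/
theorem exists_mobius (hA : IsClosed (A : Set B)) (hD : IsClosed (D : Set B)) {x : D}
    (hx : ‖x‖ < 1) {a : A} (ha : ‖a‖ ≤ 1) :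
    ∃ b : A, (b : B) = mobius (x : B) a ∧
      ∀ Φ : DCharacter A D hDA, (Φ.toAlgHom b : B) = mobius (x : B) (Φ.toAlgHom a) := by
  -- Completeness keeps the inverse in `A`; closedness of `D` keeps the square roots in `D`, where
  -- characters fix them.
  have : CompleteSpace A := hA.completeSpace_coe
  have : IsClosed (D : Set B) := hD
  let q : D := ⟨cfc (fun t : ℝ => (√t)⁻¹) (1 - (x : B) * star (x : B)),
    cfc_mem (𝕜' := ℂ) _ (1 - x * star x).2⟩
  let p : D := ⟨cfc (fun t : ℝ => √t) (1 - star (x : B) * (x : B)),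
    cfc_mem (𝕜' := ℂ) _ (1 - star x * x).2⟩
  let ι (d : D) : A := ⟨(d : B), hDA d.2⟩
  have hu : IsUnit (1 - ι (star x) * a) := isUnit_one_sub_of_norm_lt_one <|
    norm_mul_lt_one_of_lt_of_le (x := star (x : B)) (y := (a : B))
      (by rw [norm_star]; exact hx) ha
  refine ⟨ι q * (ι x - a) * Ring.inverse (1 - ι (star x) * a) * ι p, ?_, fun Φ => ?_⟩
  · have h := map_ringInverse_of_isUnit A.val hu
    simp only [Subalgebra.coe_val] at h
    simp only [Subalgebra.coe_mul, h]
    rfl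
  · have hι (d : D) : Φ.toAlgHom (ι d) = d := Φ.map_of_mem d
    have h := map_ringInverse_of_isUnit (D.subtype.toAlgHom.comp Φ.toAlgHom) hu
    have h' : ((Φ.toAlgHom (Ring.inverse (1 - ι (star x) * a)) : D) : B) =
        Ring.inverse (1 - star (x : B) * (Φ.toAlgHom a : B)) := by
      refine h.trans ?_
      congr 1
      show ((Φ.toAlgHom (1 - ι (star x) * a) : D) : B) = _
      rw [map_sub, map_one, map_mul, hι]
      rfl
    rw [map_mul, map_mul, map_mul, map_sub, hι, hι, hι]
    show (q : B) * ((x : B) - (Φ.toAlgHom a : B)) *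
      ((Φ.toAlgHom (Ring.inverse (1 - ι (star x) * a)) : D) : B) * (p : B) = _
    rw [h']
    rfl

theorem KerNormLtOne.boundedHyperbolicDist (hA : IsClosed (A : Set B)) (hD : IsClosed (D : Set B))
    {Φ Ψ : DCharacter A D hDA} (h : Ψ.KerNormLtOne Φ) : Φ.BoundedHyperbolicDist Ψ := by
  set r := ‖Ψ.toCLM.comp (LinearMap.ker Φ.toCLM.toLinearMap).subtypeL‖ with hrdef
  have hr : r < 1 := h
  have hr0 : 0 ≤ r := ContinuousLinearMap.opNorm_nonneg _
  -- The `+ 1` only ensures `M > 0` when `r = 0`.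
  refine ⟨Real.artanh r + 1, by linarith [Real.artanh_nonneg hr0], fun a ha => ?_⟩
  have hΦa : ‖Φ.toAlgHom a‖ < 1 := (Φ.contractive a).trans_lt ha
  obtain ⟨b, hb, hchar⟩ := exists_mobius (hDA := hDA) hA hD hΦa ha.le
  have hb1 : ‖b‖ ≤ 1 := by
    have := norm_mobius_le_one (x := (Φ.toAlgHom a : B)) (y := (a : B)) hΦa ha.le
    rwa [← hb] at this
  have h0 : Φ.toAlgHom b = 0 := Subtype.ext (by rw [hchar, mobius_self]; rfl)
  have h1 : ‖mobius (Φ.toAlgHom a : B) (Ψ.toAlgHom a : B)‖ ≤ r := by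
    rw [← hchar]
    exact (Ψ.norm_le_of_mem_ker Φ h0).trans (mul_le_of_le_one_right hr0 hb1)
  rw [hyperbolicDist_eq_artanh_norm_mobius]
  have := Real.artanh_le_artanh (by linarith [norm_nonneg (mobius (Φ.toAlgHom a : B)
    (Ψ.toAlgHom a : B))]) hr h1
  linarith

/-- On `Ker Φ` the distance is `ρ(0, Ψ a) = artanh ‖Ψ a‖`, so `‖Ψ a‖ ≤ tanh M < 1` on the open unit
ball. -/
theorem BoundedHyperbolicDist.kerNormLtOne {Φ Ψ : DCharacter A D hDA}
    (h : Φ.BoundedHyperbolicDist Ψ) : Ψ.KerNormLtOne Φ := by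
  obtain ⟨M, -, h⟩ := h
  by_contra hcon
  obtain ⟨a, ha0, ha1, ha⟩ := Ψ.exists_mem_ker_lt Φ (r := Real.tanh M)
    ((Real.tanh_lt_one M).trans_le (not_lt.1 hcon))
  have h1 := h a ha1
  rw [hyperbolicDist_eq_artanh_norm_mobius, ha0, ZeroMemClass.coe_zero, mobius_zero_left,
    norm_neg] at h1
  have h2 := Real.artanh_lt_artanh (Real.neg_one_lt_tanh M)
    ((Ψ.contractive a).trans_lt ha1) ha
  rw [Real.artanh_tanh] at h2
  exact absurd h1 (not_le.2 h2)

/-! ### Equivalence of the conditions and Gleason parts -/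

theorem gleasonEquiv_iff_kerNormLtOne (hA : IsClosed (A : Set B)) {Φ Ψ : DCharacter A D hDA} :
    Φ.GleasonEquiv Ψ ↔ Φ.KerNormLtOne Ψ :=
  ⟨fun h => h.kerNormLtOne hA, fun h => h.gleasonEquiv⟩

theorem gleasonEquiv_iff_boundedHyperbolicDist (hA : IsClosed (A : Set B))
    (hD : IsClosed (D : Set B)) {Φ Ψ : DCharacter A D hDA} :
    Φ.GleasonEquiv Ψ ↔ Φ.BoundedHyperbolicDist Ψ :=
  ⟨fun h => ((gleasonEquiv_comm.1 h).kerNormLtOne hA).boundedHyperbolicDist hA hD,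
    fun h => gleasonEquiv_comm.1 h.kerNormLtOne.gleasonEquiv⟩

theorem gleasonEquiv_iff_normingSeq (hA : IsClosed (A : Set B)) {Φ Ψ : DCharacter A D hDA} :
    Φ.GleasonEquiv Ψ ↔ Φ.NormingSeq Ψ :=
  ⟨fun h => (h.kerNormLtOne hA).normingSeq, fun h => h.kerNormLtOne.gleasonEquiv⟩

theorem gleasonEquiv_equivalence (hA : IsClosed (A : Set B)) :
    Equivalence (GleasonEquiv (hDA := hDA)) where
  refl Φ := by simp [GleasonEquiv, ContinuousLinearMap.opNorm_zero]
  symm := gleasonEquiv_comm.1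
  trans h₁ h₂ := by
    rw [gleasonEquiv_iff_normingSeq hA] at *
    exact fun a ha hlim => h₂ a ha (h₁ a ha hlim)

theorem isPartition_range_gleasonPart (hA : IsClosed (A : Set B)) :
    Setoid.IsPartition (Set.range (gleasonPart (hDA := hDA))) := by
  convert! Setoid.isPartition_classes ⟨_, gleasonEquiv_equivalence (hDA := hDA) hA⟩ using 1
  ext S
  refine exists_congr fun Φ => ?_
  have : gleasonPart Φ = {Ψ | Ψ.GleasonEquiv Φ} := Set.ext fun Ψ => gleasonEquiv_comm
  rw [this]
  exact eq_comm

end DCharacter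

end

theorem mainTheorem9 {B : Type*} [CStarAlgebra B]
    (A : Subalgebra ℂ B) (hA : IsClosed (A : Set B))
    (D : StarSubalgebra ℂ B) (hD : IsClosed (D : Set B)) (hDA : D.toSubalgebra ≤ A) :
    (∀ Φ Ψ : DCharacter A D hDA,
      List.TFAE [Φ.GleasonEquiv Ψ, Φ.KerNormLtOne Ψ, Φ.BoundedHyperbolicDist Ψ, Φ.NormingSeq Ψ]) ∧
    Equivalence (DCharacter.GleasonEquiv (hDA := hDA)) ∧
    Equivalence (DCharacter.KerNormLtOne (hDA := hDA)) ∧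
    Equivalence (DCharacter.BoundedHyperbolicDist (hDA := hDA)) ∧
    Equivalence (DCharacter.NormingSeq (hDA := hDA)) ∧
    Setoid.IsPartition (Set.range (DCharacter.gleasonPart (hDA := hDA))) := by
  have h2 : DCharacter.GleasonEquiv (hDA := hDA) = DCharacter.KerNormLtOne := by
    ext; exact DCharacter.gleasonEquiv_iff_kerNormLtOne hA
  have h3 : DCharacter.GleasonEquiv (hDA := hDA) = DCharacter.BoundedHyperbolicDist := by
    ext; exact DCharacter.gleasonEquiv_iff_boundedHyperbolicDist hA hD
  have h4 : DCharacter.GleasonEquiv (hDA := hDA) = DCharacter.NormingSeq := by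
    ext; exact DCharacter.gleasonEquiv_iff_normingSeq hA
  have he := DCharacter.gleasonEquiv_equivalence (hDA := hDA) hA
  refine ⟨fun Φ Ψ => ?_, he, h2 ▸ he, h3 ▸ he, h4 ▸ he,
    DCharacter.isPartition_range_gleasonPart hA⟩
  rw [← h2, ← h3, ← h4]
  simp
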